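/- Let $G=(V,E\cup A)$ be a finite mixed graph with set of undirected edges $E$ and set of directed arcs $A$, without loops but possibly with parallel edges or arcs. Call a subset $F\subseteq E\cup A$ a mixed edge cover if for every $v\in V$ there is a directed path (possibly of length $0$) in $F\cap A$ from an endpoint of some edge $e\in F\cap E$ to $v$. Suppose that $E\cup A$ can be partitioned into $k$ mixed edge covers. Then $E\cup A$ can be partitioned into $k$ mixed edge covers $F_1,\dots,F_k$ such that, for all $i,j\in\{1,\dots,k\}$, $$\bigl||F_i|-|F_j|\bigr|\le 1,\qquad \bigl||F_i\cap E|-|F_j\cap E|\bigr|\le 2,\qquad \bigl||F_i\cap A|-|F_j\cap A|\bigr|\le 2.$$ -/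

import Mathlib

/-- A mixed graph on the vertex set `V`, with undirected edges labelled by `E` and directed arcs
labelled by `A`. Parallel edges and parallel arcs are allowed; loops (edges or arcs) are not. -/
structure MixedGraph (V E A : Type*) where
  /-- the unordered pair of endpoints of an edge -/
  ends : E → Sym2 V
  /-- the tail of an arc -/
  tail : A → V
  /-- the head of an arc -/
  head : A → V
  edge_loopless : ∀ e, ¬ (ends e).IsDiag
  arc_loopless : ∀ a, tail a ≠ head a

namespace MixedGraph

variable {V E A : Type*}

/-- `G.ArcStep F u w`: some arc of `F` leads from `u` to `w`. -/
def ArcStep (G : MixedGraph V E A) (F : Finset (E ⊕ A)) (u w : V) : Prop :=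
  ∃ a : A, Sum.inr a ∈ F ∧ G.tail a = u ∧ G.head a = w

/-- `w` can be reached from `u` by a directed path, possibly of length `0`, of arcs of `F`. -/
def Reachable (G : MixedGraph V E A) (F : Finset (E ⊕ A)) (u w : V) : Prop :=
  Relation.ReflTransGen (G.ArcStep F) u w

/-- A set `F` of edges and arcs is a mixed edge cover if every vertex can be reached, by a directed
path of arcs of `F`, from an endpoint of some edge of `F`. -/
def IsMixedEdgeCover (G : MixedGraph V E A) (F : Finset (E ⊕ A)) : Prop :=
  ∀ v : V, ∃ e : E, Sum.inl e ∈ F ∧ ∃ u ∈ G.ends e, G.Reachable F u v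

/-- The sets `F 0, …, F (k - 1)` are mixed edge covers that partition the set of all edges and
arcs: they are pairwise disjoint and every edge and every arc lies in one of them. -/
def IsMixedEdgeCoverPartition (G : MixedGraph V E A) {k : ℕ}
    (F : Fin k → Finset (E ⊕ A)) : Prop :=
  (∀ i, G.IsMixedEdgeCover (F i)) ∧ (∀ i j, i ≠ j → Disjoint (F i) (F j)) ∧
    ∀ x : E ⊕ A, ∃ i, x ∈ F i

/-- The edge part `F ∩ E`. -/
def edgePart (F : Finset (E ⊕ A)) : Finset E := F.toLeft

/-- The arc part `F ∩ A`. -/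
def arcPart (F : Finset (E ⊕ A)) : Finset A := F.toRight

end MixedGraph

/-! It suffices to rebalance two covers at a time: among all partitions, one minimizing a quadratic
potential in the sizes has only balanced pairs, since `exists_balanced_pair` would otherwise lower
the potential.

For two covers with arc union `B`, view the edge split as a 2-colouring. By Edmonds' disjoint
branchings theorem (`exists_branching`), a colouring extends to two covers if each minimal nonempty
set not entered by `B` meets both colours; sets missed by all edges are no obstacle, as the original
covers already supply two entering arcs. Each colour then needs only `|V|` minus its number of
covered vertices in arcs, and the surplus arcs are free. So one must recolour the edges, keeping
these meetings and the total vertex coverage, with edge counts and coverage nearly balanced.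

To this end, choose a representative half-edge for each covered pair (vertex, colour) and link
opposite-coloured representatives that must stay opposite. Links and edges form paths and cycles on
the half-edges. In a maximal linking, unlinked half-edges on the same side (representative or not)
are the two ends of one path, so each side has at most two of them and its sign sum is at most 2 in
absolute value (`exists_balanced_signs`). -/

/-! ### Products of two involutions -/

/-- The involution exchanging the two half-edges of every edge. -/
def halfEdgeFlip (ε : Type*) : Equiv.Perm (ε × Bool) where
  toFun h := (h.1, !h.2)
  invFun h := (h.1, !h.2)
  left_inv h := by simp
  right_inv h := by simp

/-- The powers of the product of two involutions `σ`, `τ` move a fixed point `x` of `σ` to at most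
one other fixed point of `σ`. -/
theorem Equiv.Perm.eq_of_sameCycle_mul_of_fixed {H : Type*} {σ τ : Equiv.Perm H}
    (hσ : ∀ h, σ (σ h) = h) (hτ : ∀ h, τ (τ h) = h) {x y z : H} (hx : σ x = x) (hy : σ y = y)
    (hz : σ z = z) (hxy : (σ * τ).SameCycle x y) (hxz : (σ * τ).SameCycle x z) (hyx : y ≠ x)
    (hzx : z ≠ x) : y = z := by
  set g := σ * τ with hg
  have h1 : σ * σ = 1 := by ext h; simp [hσ]
  have h2 : τ * τ = 1 := by ext h; simp [hτ]
  have hσi : σ⁻¹ = σ := inv_eq_of_mul_eq_one_left h1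
  have hτi : τ⁻¹ = τ := inv_eq_of_mul_eq_one_left h2
  -- `σ` acts on the orbit of its fixed point `x` as the reflection `g ^ n x ↦ g ^ (-n) x`.
  have hconj : σ * g * σ⁻¹ = g⁻¹ := by
    rw [hg, mul_inv_rev, hσi, hτi, ← mul_assoc σ σ τ, h1, one_mul]
  have hpow : ∀ n : ℤ, σ ((g ^ n) x) = (g ^ (-n)) x := by
    intro n
    have : σ * g ^ n * σ⁻¹ = g ^ (-n) := by
      rw [← conj_zpow, hconj, inv_zpow, zpow_neg]
    rw [← this, hσi]
    simp [hx]
  -- An infinite orbit gives `N = 0`; divisibility by `N` covers both cases.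
  set N : ℤ := (Function.minimalPeriod (g • ·) x : ℤ)
  have hN : ∀ n : ℤ, (g ^ n) x = x ↔ N ∣ n := fun n =>
    MulAction.zpow_smul_eq_iff_minimalPeriod_dvd (a := g) (b := x) (n := n)
  have hdvd : ∀ n : ℤ, σ ((g ^ n) x) = (g ^ n) x → N ∣ 2 * n := by
    intro n hn
    rw [hpow] at hn
    rw [← hN, two_mul, zpow_add, Equiv.Perm.mul_apply, ← hn, ← Equiv.Perm.mul_apply, ← zpow_add]
    simp
  obtain ⟨m, rfl⟩ := hxy
  obtain ⟨n, rfl⟩ := hxz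
  have hm := hdvd m hy
  have hn := hdvd n hz
  rw [Ne, hN] at hyx hzx
  obtain ⟨a, ha⟩ := hm
  obtain ⟨b, hb⟩ := hn
  -- Other fixed points sit at odd multiples of `N / 2`, and any two of these agree modulo `N`.
  have odd_of : ∀ {m a : ℤ}, 2 * m = N * a → ¬ N ∣ m → a % 2 = 1 := by
    intro m a ha hm
    by_contra h
    obtain ⟨t, rfl⟩ : (2 : ℤ) ∣ a := by omega
    exact hm ⟨t, by linarith⟩
  have ha' := odd_of ha hyx
  have hb' := odd_of hb hzx
  obtain ⟨t, ht⟩ : (2 : ℤ) ∣ a - b := by omega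
  have hmn : (g ^ (m - n)) x = x := (hN _).2 ⟨t, by
    have : N * a - N * b = N * (2 * t) := by rw [← mul_sub, ht]
    linarith⟩
  have : (g ^ m) x = (g ^ n) ((g ^ (m - n)) x) := by
    rw [← Equiv.Perm.mul_apply, ← zpow_add]; congr 2; ring
  rw [this, hmn]

/-- The orbit of a fixed point of the involution `σ` under `σ * τ` is closed under `σ` and `τ`. -/
theorem Equiv.Perm.sameCycle_mul_apply_of_fixed {H : Type*} {σ τ : Equiv.Perm H}
    (hσ : ∀ h, σ (σ h) = h) (hτ : ∀ h, τ (τ h) = h) {x y : H} (hx : σ x = x)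
    (hxy : (σ * τ).SameCycle x y) :
    (σ * τ).SameCycle x (σ y) ∧ (σ * τ).SameCycle x (τ y) := by
  set g := σ * τ with hg
  have h1 : σ * σ = 1 := by ext h; simp [hσ]
  have h2 : τ * τ = 1 := by ext h; simp [hτ]
  have hσi : σ⁻¹ = σ := inv_eq_of_mul_eq_one_left h1
  have hτi : τ⁻¹ = τ := inv_eq_of_mul_eq_one_left h2
  have hginv : g⁻¹ = τ * σ := by rw [hg, mul_inv_rev, hσi, hτi]
  have hconj : σ * g * σ⁻¹ = g⁻¹ := by
    rw [hginv, hg, hσi, ← mul_assoc σ σ τ, h1, one_mul]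
  have key : ∀ y, g.SameCycle x y → g.SameCycle x (σ y) := by
    rintro _ ⟨n, rfl⟩
    refine ⟨-n, ?_⟩
    have : σ * g ^ n * σ⁻¹ = g ^ (-n) := by
      rw [← conj_zpow, hconj, inv_zpow, zpow_neg]
    rw [← this, hσi]
    simp [hx]
  refine ⟨key y hxy, ?_⟩
  have : τ y = g⁻¹ (σ y) := by rw [hginv]; simp [hσ]
  rw [this]
  exact Equiv.Perm.sameCycle_symm_apply_right.2 (key y hxy)

/-! ### Signed linkings and balanced signs -/

/-- `c` assigns signs to edges so that half-edges linked by the involution `σ` get opposite signs;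
`σ` links only half-edges on the same side of `P`. -/
structure IsSignedLinking {ε : Type*} (P : Finset (ε × Bool)) (σ : Equiv.Perm (ε × Bool))
    (c : ε → ℤˣ) : Prop where
  invol : ∀ h, σ (σ h) = h
  mem_iff : ∀ h, σ h ∈ P ↔ h ∈ P
  opp : ∀ h, σ h ≠ h → c (σ h).1 = - c h.1

namespace IsSignedLinking

variable {ε : Type*} {P : Finset (ε × Bool)} {σ : Equiv.Perm (ε × Bool)} {c : ε → ℤˣ}

/-- As `S` is closed under linking, each link has both of its signs reversed or neither. -/
theorem flip (hc : IsSignedLinking P σ c) (S : Set ε) [DecidablePred (· ∈ S)] (hS : ∀ h, h.1 ∈ S → (σ h).1 ∈ S) :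
    IsSignedLinking P σ (fun e => if e ∈ S then - c e else c e) := by
  refine ⟨hc.invol, hc.mem_iff, fun h hh => ?_⟩
  have : (σ h).1 ∈ S ↔ h.1 ∈ S := ⟨fun h' => by simpa [hc.invol] using hS _ h', hS h⟩
  by_cases h1 : h.1 ∈ S <;> simp [this, h1, hc.opp h hh]

/-- Adds a link between two unlinked half-edges; this is what contradicts maximality of a linking.
-/
theorem swap [DecidableEq ε] (hc : IsSignedLinking P σ c) {x y : ε × Bool} (hx : σ x = x)
    (hy : σ y = y) (hP : x ∈ P ↔ y ∈ P) (hxy : c x.1 ≠ c y.1) :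
    IsSignedLinking P (σ * Equiv.swap x y) c := by
  have hne : x ≠ y := fun h => hxy (by rw [h])
  have hopp : c x.1 = - c y.1 := by
    rcases Int.units_eq_one_or (c x.1) with h1 | h1 <;>
      rcases Int.units_eq_one_or (c y.1) with h2 | h2 <;> simp_all
  have hopp' : c y.1 = - c x.1 := by rw [hopp, neg_neg]
  have hval : ∀ h, (h = x ∧ (σ * Equiv.swap x y) h = y) ∨ (h = y ∧ (σ * Equiv.swap x y) h = x) ∨
      (h ≠ x ∧ h ≠ y ∧ (σ * Equiv.swap x y) h = σ h) := by
    intro h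
    by_cases h1 : h = x
    · left; subst h1; simp [hy]
    by_cases h2 : h = y
    · right; left; subst h2; simp [hx]
    · right; right; simp [h1, h2, Equiv.swap_apply_of_ne_of_ne h1 h2]
  refine ⟨fun h => ?_, fun h => ?_, fun h hh => ?_⟩
  · rcases hval h with ⟨rfl, h1⟩ | ⟨rfl, h1⟩ | ⟨h1, h2, h3⟩
    · rw [h1]; simp [hx]
    · rw [h1]; simp [hy]
    · have h4 : σ h ≠ x := fun h' => h1 (by rw [← hc.invol h, h', hx])
      have h5 : σ h ≠ y := fun h' => h2 (by rw [← hc.invol h, h', hy])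
      rw [h3, Equiv.Perm.mul_apply, Equiv.swap_apply_of_ne_of_ne h4 h5, hc.invol]
  · rcases hval h with ⟨rfl, h1⟩ | ⟨rfl, h1⟩ | ⟨h1, h2, h3⟩
    · rw [h1, hP]
    · rw [h1, hP]
    · rw [h3, hc.mem_iff]
  · rcases hval h with ⟨rfl, h1⟩ | ⟨rfl, h1⟩ | ⟨h1, h2, h3⟩
    · rw [h1, hopp']
    · rw [h1, hopp]
    · rw [h3] at hh ⊢
      exact hc.opp h hh

/-- Linked half-edges cancel in a sum of signs over a set that is closed under linking. -/
theorem sum_eq_sum_fixed [DecidableEq ε] (hc : IsSignedLinking P σ c) (Q : Finset (ε × Bool))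
    (hQ : ∀ h ∈ Q, σ h ∈ Q) :
    ∑ h ∈ Q, (c h.1 : ℤ) = ∑ h ∈ Q with σ h = h, (c h.1 : ℤ) := by
  rw [← Finset.sum_filter_add_sum_filter_not Q (fun h => σ h = h), add_eq_left]
  refine Finset.sum_involution (fun h _ => σ h) ?_ ?_ ?_ ?_
  · intro h hh
    simp [hc.opp h (Finset.mem_filter.1 hh).2]
  · intro h hh _
    exact (Finset.mem_filter.1 hh).2
  · intro h hh
    rw [Finset.mem_filter] at hh ⊢
    exact ⟨hQ h hh.1, fun h' => hh.2 (σ.injective h')⟩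
  · intro h _
    exact hc.invol h

end IsSignedLinking

/-- A sum of at most two signs that are all equal. -/
theorem sum_units_of_card_le_two {H : Type*} (Q : Finset H) (c : H → ℤˣ)
    (h2 : Q.card ≤ 2) (hc : ∀ x ∈ Q, ∀ y ∈ Q, c x = c y) :
    |∑ h ∈ Q, (c h : ℤ)| ≤ 2 ∧ (|∑ h ∈ Q, (c h : ℤ)| = 2 → Q.card = 2) := by
  classical
  rcases Q.eq_empty_or_nonempty with rfl | ⟨x, hx⟩
  · simp
  have : ∑ h ∈ Q, (c h : ℤ) = Q.card * (c x : ℤ) := by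
    rw [Finset.sum_congr rfl (fun y hy => by rw [hc y hy x hx]), Finset.sum_const, nsmul_eq_mul]
  rw [this]
  rcases Int.units_eq_one_or (c x) with h | h <;> simp [h] <;> omega

/-- Signs on edges that are opposite along a linking of half-edges can be rechosen so that the
total sign and the total sign of the half-edges in `P` are simultaneously nearly balanced. -/
theorem exists_balanced_signs {ε : Type*} [Fintype ε] [DecidableEq ε] (P : Finset (ε × Bool))
    (σ₀ : Equiv.Perm (ε × Bool)) (c₀ : ε → ℤˣ) (h₀ : IsSignedLinking P σ₀ c₀) :
    ∃ c : ε → ℤˣ, IsSignedLinking P σ₀ c ∧ |∑ e, (c e : ℤ)| ≤ 2 ∧ |∑ h ∈ P, (c h.1 : ℤ)| ≤ 2 ∧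
      |∑ e, (c e : ℤ) - ∑ h ∈ P, (c h.1 : ℤ)| ≤ 1 := by
  classical
  -- Linkings extending `σ₀`, with the signs allowed to vary; fewest fixed points means most links.
  let good : Finset (Equiv.Perm (ε × Bool) × (ε → ℤˣ)) :=
    Finset.univ.filter fun p => IsSignedLinking P p.1 p.2 ∧ ∀ h, σ₀ h ≠ h → p.1 h = σ₀ h
  obtain ⟨⟨σ, c⟩, hmem, hmin⟩ := Finset.exists_min_image good
    (fun p => (Finset.univ.filter fun h => p.1 h = h).card) ⟨(σ₀, c₀), by simp [good, h₀]⟩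
  have hgood : ∀ p, p ∈ good ↔ IsSignedLinking P p.1 p.2 ∧ ∀ h, σ₀ h ≠ h → p.1 h = σ₀ h := by
    intro p; simp [good]
  have hc : IsSignedLinking P σ c := ((hgood _).1 hmem).1
  have hext : ∀ h, σ₀ h ≠ h → σ h = σ₀ h := ((hgood _).1 hmem).2
  have hres : ∀ c', IsSignedLinking P σ c' → IsSignedLinking P σ₀ c' := by
    intro c' hc'
    refine ⟨h₀.invol, h₀.mem_iff, fun h hh => ?_⟩
    rw [← hext h hh]
    exact hc'.opp h (by rw [hext h hh]; exact hh)
  -- Otherwise `x` and `y` could be linked. This holds for every admissible `c'`, so it survives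
  -- flips.
  have hsame : ∀ c', IsSignedLinking P σ c' → ∀ x y, σ x = x → σ y = y → (x ∈ P ↔ y ∈ P) →
      c' x.1 = c' y.1 := by
    intro c' hc' x y hx hy hP
    by_contra hxy
    have hne : x ≠ y := fun h => hxy (by rw [h])
    have hsw := hc'.swap hx hy hP hxy
    have hin : (σ * Equiv.swap x y, c') ∈ good := by
      refine (hgood _).2 ⟨hsw, fun h hh => ?_⟩
      have h1 : h ≠ x := fun h' => hh (by rw [← hext h hh, h']; exact hx)
      have h2 : h ≠ y := fun h' => hh (by rw [← hext h hh, h']; exact hy)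
      simp only [Equiv.Perm.mul_apply, Equiv.swap_apply_of_ne_of_ne h1 h2]
      exact hext h hh
    refine absurd (hmin _ hin) (not_le.2 (Finset.card_lt_card ?_))
    refine ⟨fun h hh => ?_, fun hsub => ?_⟩
    · have hh' : σ (Equiv.swap x y h) = h := (Finset.mem_filter.1 hh).2
      refine Finset.mem_filter.2 ⟨Finset.mem_univ _, ?_⟩
      change σ h = h
      by_cases h1 : h = x
      · rw [h1]; exact hx
      by_cases h2 : h = y
      · rw [h2]; exact hy
      rwa [Equiv.swap_apply_of_ne_of_ne h1 h2] at hh'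
    · have h1 : σ (Equiv.swap x y x) = x :=
        (Finset.mem_filter.1 (hsub (Finset.mem_filter.2 ⟨Finset.mem_univ x, hx⟩))).2
      rw [Equiv.swap_apply_left, hy] at h1
      exact hne h1.symm
  set τ := halfEdgeFlip ε with hτdef
  have hτ : ∀ h, τ (τ h) = h := by intro h; simp [hτdef, halfEdgeFlip]
  -- For an unlinked `x`, these are the edges of the path that starts at `x` and alternates between
  -- edges and links.
  let S : ε × Bool → Set ε := fun x => {e | ∃ b, (σ * τ).SameCycle x (e, b)}
  have hSmem : ∀ x, σ x = x → ∀ h : ε × Bool, h.1 ∈ S x → (σ * τ).SameCycle x h := by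
    rintro x hx ⟨e, b⟩ ⟨b', hb'⟩
    have := (Equiv.Perm.sameCycle_mul_apply_of_fixed hc.invol hτ hx hb').2
    have h1 : τ (e, b') = (e, !b') := rfl
    rw [h1] at this
    cases b <;> cases b' <;> simp_all
  have hScl : ∀ x, σ x = x → ∀ h : ε × Bool, h.1 ∈ S x → (σ h).1 ∈ S x := fun x hx h hh =>
    ⟨(σ h).2, (Equiv.Perm.sameCycle_mul_apply_of_fixed hc.invol hτ hx (hSmem x hx h hh)).1⟩
  have hself : ∀ x, x.1 ∈ S x := fun x => ⟨x.2, Equiv.Perm.SameCycle.refl _ _⟩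
  -- If the path from `x` missed `y`, flipping it would change the sign at `x` only, against
  -- `hsame`.
  have hconn : ∀ x y, σ x = x → σ y = y → (x ∈ P ↔ y ∈ P) → (σ * τ).SameCycle x y := by
    intro x y hx hy hP
    by_contra h
    have h1 : y.1 ∉ S x := fun h' => h (hSmem x hx y h')
    have h2 := hsame _ (hc.flip (S x) (hScl x hx)) x y hx hy hP
    simp only [hself x, h1, if_true, if_false] at h2
    have h3 := hsame c hc x y hx hy hP
    rw [h3] at h2
    exact absurd h2 (by rcases Int.units_eq_one_or (c y.1) with h | h <;> rw [h] <;> decide)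
  have hcard : ∀ Q : Finset (ε × Bool), (∀ x ∈ Q, ∀ y ∈ Q, (x ∈ P ↔ y ∈ P)) →
      (Q.filter fun h => σ h = h).card ≤ 2 := by
    intro Q hQ
    by_contra h
    obtain ⟨x, y, z, hx, hy, hz, hxy, hxz, hyz⟩ := Finset.two_lt_card_iff.1 (not_le.1 h)
    rw [Finset.mem_filter] at hx hy hz
    exact hyz (Equiv.Perm.eq_of_sameCycle_mul_of_fixed hc.invol hτ hx.2 hy.2 hz.2
      (hconn x y hx.2 hy.2 (hQ x hx.1 y hy.1)) (hconn x z hx.2 hz.2 (hQ x hx.1 z hz.1))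
      hxy.symm hxz.symm)
  have hPside : ∀ x ∈ P, ∀ y ∈ P, (x ∈ P ↔ y ∈ P) := by intro x hx y hy; simp [hx, hy]
  have hNside : ∀ x ∈ Pᶜ, ∀ y ∈ Pᶜ, (x ∈ P ↔ y ∈ P) := by
    intro x hx y hy; simp_all
  have hbound : ∀ c', IsSignedLinking P σ c' → ∀ Q : Finset (ε × Bool),
      (∀ h ∈ Q, σ h ∈ Q) → (∀ x ∈ Q, ∀ y ∈ Q, (x ∈ P ↔ y ∈ P)) →
      |∑ h ∈ Q, (c' h.1 : ℤ)| ≤ 2 ∧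
      (|∑ h ∈ Q, (c' h.1 : ℤ)| = 2 → (Q.filter fun h => σ h = h).card = 2) := by
    intro c' hc' Q hQσ hQ
    rw [hc'.sum_eq_sum_fixed Q hQσ]
    have hu := sum_units_of_card_le_two (Q.filter fun h => σ h = h) (fun h => c' h.1)
      (hcard Q hQ) fun x hx y hy => hsame c' hc' x y (Finset.mem_filter.1 hx).2
        (Finset.mem_filter.1 hy).2
        (hQ x (Finset.mem_filter.1 hx).1 y (Finset.mem_filter.1 hy).1)
    exact hu
  have hPσ : ∀ h ∈ P, σ h ∈ P := fun h hh => (hc.mem_iff h).2 hh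
  have hNσ : ∀ h ∈ Pᶜ, σ h ∈ Pᶜ := fun h hh => by
    rw [Finset.mem_compl] at hh ⊢; rwa [hc.mem_iff]
  have htotal : ∀ c' : ε → ℤˣ, 2 * ∑ e, (c' e : ℤ) =
      ∑ h ∈ P, (c' h.1 : ℤ) + ∑ h ∈ Pᶜ, (c' h.1 : ℤ) := by
    intro c'
    rw [Finset.sum_add_sum_compl, Fintype.sum_prod_type, Finset.mul_sum]
    simp [two_mul]
  by_cases hbad : |∑ e, (c e : ℤ) - ∑ h ∈ P, (c h.1 : ℤ)| ≤ 1
  · refine ⟨c, hres c hc, ?_, (hbound c hc P hPσ hPside).1, hbad⟩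
    have h1 := (hbound c hc P hPσ hPside).1
    have h2 := (hbound c hc Pᶜ hNσ hNside).1
    have h3 := htotal c
    rw [abs_le] at *
    omega
  -- With sign sums `p` over `P` and `q` over its complement, the total is `(p + q) / 2` and its
  -- excess over `p` is `(q - p) / 2`. Failure therefore forces `p = -q = ±2`. Flipping the path
  -- that joins the two unlinked half-edges of `P` negates `p` and keeps `q`, since that path has no
  -- third end.
  obtain ⟨hp1, hp2⟩ := hbound c hc P hPσ hPside
  obtain ⟨hn1, hn2⟩ := hbound c hc Pᶜ hNσ hNside
  have ht := htotal c
  have hPabs : |∑ h ∈ P, (c h.1 : ℤ)| = 2 := by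
    rw [abs_le] at hbad hp1 hn1
    rcases abs_cases (∑ h ∈ P, (c h.1 : ℤ)) with h | h <;> omega
  obtain ⟨x, y, hxy, hPf⟩ := Finset.card_eq_two.1 (hp2 hPabs)
  have hxP : x ∈ P.filter fun h => σ h = h := by rw [hPf]; simp
  have hyP : y ∈ P.filter fun h => σ h = h := by rw [hPf]; simp
  rw [Finset.mem_filter] at hxP hyP
  have hyc := hconn x y hxP.2 hyP.2 (hPside x hxP.1 y hyP.1)
  have hyS : y.1 ∈ S x := ⟨y.2, hyc⟩
  set c' : ε → ℤˣ := fun e => if e ∈ S x then - c e else c e with hc'def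
  have hc' : IsSignedLinking P σ c' := hc.flip (S x) (hScl x hxP.2)
  have hP' : ∑ h ∈ P, (c' h.1 : ℤ) = - ∑ h ∈ P, (c h.1 : ℤ) := by
    rw [hc'.sum_eq_sum_fixed P hPσ, hc.sum_eq_sum_fixed P hPσ, hPf, Finset.sum_pair hxy,
      Finset.sum_pair hxy]
    simp only [hc'def, hself x, hyS, if_true]
    push_cast; ring
  have hN' : ∑ h ∈ Pᶜ, (c' h.1 : ℤ) = ∑ h ∈ Pᶜ, (c h.1 : ℤ) := by
    rw [hc'.sum_eq_sum_fixed Pᶜ hNσ, hc.sum_eq_sum_fixed Pᶜ hNσ]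
    refine Finset.sum_congr rfl fun z hz => ?_
    rw [Finset.mem_filter, Finset.mem_compl] at hz
    have : z.1 ∉ S x := by
      intro hzS
      have hzc := hSmem x hxP.2 z hzS
      have := Equiv.Perm.eq_of_sameCycle_mul_of_fixed hc.invol hτ hxP.2 hyP.2 hz.2 hyc hzc hxy.symm
        (fun h => hz.1 (h ▸ hxP.1))
      exact hz.1 (this ▸ hyP.1)
    simp [hc'def, this]
  have ht' := htotal c'
  refine ⟨c', hres c' hc', ?_⟩
  rw [hP', hN'] at ht'
  rw [hP']
  simp only [abs_le] at *
  rcases abs_cases (∑ h ∈ P, (c h.1 : ℤ)) with h | h <;> omega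

/-! ### Balanced recolouring of edges -/

/-- The vertices that lie on an edge of sign `s`, where `vt` gives the vertices of half-edges. -/
def coveredVertices {V ε : Type*} [Fintype ε] [DecidableEq V] (vt : ε × Bool → V) (c : ε → ℤˣ)
    (s : ℤˣ) : Finset V :=
  (Finset.univ.filter fun h : ε × Bool => c h.1 = s).image vt

theorem mem_coveredVertices {V ε : Type*} [Fintype ε] [DecidableEq V] {vt : ε × Bool → V}
    {c : ε → ℤˣ} {s : ℤˣ} {u : V} :
    u ∈ coveredVertices vt c s ↔ ∃ h : ε × Bool, c h.1 = s ∧ vt h = u := by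
  simp [coveredVertices]

theorem sum_units_eq_card_sub_card {H : Type*} (Q : Finset H) (c : H → ℤˣ) :
    ∑ h ∈ Q, (c h : ℤ) =
      ((Q.filter fun h => c h = 1).card : ℤ) - (Q.filter fun h => c h = -1).card := by
  rw [Finset.card_filter, Finset.card_filter]
  push_cast
  rw [← Finset.sum_sub_distrib]
  refine Finset.sum_congr rfl fun h _ => ?_
  rcases Int.units_eq_one_or (c h) with h | h <;> rw [h] <;> decide

theorem card_filter_units_add {H : Type*} (Q : Finset H) (c : H → ℤˣ) :
    (Q.filter fun h => c h = 1).card + (Q.filter fun h => c h = -1).card = Q.card := by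
  rw [← Finset.card_filter_add_card_filter_not (s := Q) (fun h => c h = 1)]
  congr 2
  ext h
  rcases Int.units_eq_one_or (c h) with h | h <;> simp [h]

/-- Given signs on the edges and a family of disjoint vertex sets that meet edges of both signs,
the signs can be rechosen to be balanced, with respect to the number of edges and (lower bounds on)
the number of covered vertices. -/
theorem exists_balanced_coloring {V ε : Type*} [Fintype ε] [DecidableEq ε] [DecidableEq V]
    [Finite V] (vt : ε × Bool → V) (c₀ : ε → ℤˣ) (𝒳 : Set (Finset V))
    (hdisj : ∀ X ∈ 𝒳, ∀ Y ∈ 𝒳, X ≠ Y → Disjoint X Y)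
    (hmeet : ∀ X ∈ 𝒳, ∀ s, ∃ u ∈ X, u ∈ coveredVertices vt c₀ s) :
    ∃ c : ε → ℤˣ, (∀ X ∈ 𝒳, ∀ s, ∃ u ∈ X, u ∈ coveredVertices vt c s) ∧
      ∃ v₁ v₂ : ℕ, v₁ ≤ (coveredVertices vt c 1).card ∧ v₂ ≤ (coveredVertices vt c (-1)).card ∧
        v₁ + v₂ = (coveredVertices vt c₀ 1).card + (coveredVertices vt c₀ (-1)).card ∧
        |∑ e, (c e : ℤ)| ≤ 2 ∧ |(v₁ : ℤ) - v₂| ≤ 2 ∧ |∑ e, (c e : ℤ) - (v₁ - v₂)| ≤ 1 := by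
  classical
  have hne : ∀ s : ℤˣ, s ≠ -s := by decide
  have hor : ∀ a b s : ℤˣ, a ≠ b → s = a ∨ s = b := by decide
  have hneg : ∀ a b : ℤˣ, a ≠ b → b = -a := by decide
  let K := {p : V × ℤˣ // p.1 ∈ coveredVertices vt c₀ p.2}
  have hK : ∀ p : K, ∃ h : ε × Bool, c₀ h.1 = p.1.2 ∧ vt h = p.1.1 := fun p =>
    mem_coveredVertices.1 p.2
  choose r hrc hrv using hK
  have hrinj : Function.Injective r := by
    intro p q hpq
    refine Subtype.ext (Prod.ext ?_ ?_)
    · rw [← hrv, ← hrv, hpq]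
    · rw [← hrc, ← hrc, hpq]
  -- A member of `𝒳` with a vertex covered in both colours is served by that singleton; discarding
  -- it makes the family disjoint.
  let 𝒴 : Set (Finset V) := {Y | (∃ u, Y = {u} ∧ ∀ s, u ∈ coveredVertices vt c₀ s) ∨
    (Y ∈ 𝒳 ∧ ∀ u ∈ Y, ¬ ∀ s, u ∈ coveredVertices vt c₀ s)}
  have hYdisj : ∀ X ∈ 𝒴, ∀ Y ∈ 𝒴, X ≠ Y → Disjoint X Y := by
    rintro X (⟨u, rfl, hu⟩ | ⟨hX, hX'⟩) Y (⟨w, rfl, hw⟩ | ⟨hY, hY'⟩) hXY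
    · simpa using fun h : u = w => hXY (by rw [h])
    · exact Finset.disjoint_singleton_left.2 fun h => hY' u h hu
    · exact Finset.disjoint_singleton_right.2 fun h => hX' w h hw
    · exact hdisj X hX Y hY hXY
  have hYmeet : ∀ q : 𝒴 × ℤˣ, ∃ u ∈ q.1.1, u ∈ coveredVertices vt c₀ q.2 := by
    rintro ⟨⟨Y, ⟨u, rfl, hu⟩ | ⟨hY, _⟩⟩, s⟩
    · exact ⟨u, Finset.mem_singleton_self u, hu s⟩
    · exact hmeet Y hY s
  choose f hfY hfc using hYmeet
  let ι : 𝒴 × ℤˣ ↪ K := ⟨fun q => ⟨(f q, q.2), hfc q⟩, by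
    rintro ⟨Y, s⟩ ⟨Z, t⟩ h
    have h1 : f (Y, s) = f (Z, t) := congrArg (fun p : K => p.1.1) h
    have h2 : s = t := congrArg (fun p : K => p.1.2) h
    subst h2
    have : Y = Z := by
      by_contra hYZ
      refine Finset.disjoint_left.1 (hYdisj Y.1 Y.2 Z.1 Z.2 fun h => hYZ (Subtype.ext h))
        (hfY (Y, s)) ?_
      rw [h1]
      exact hfY (Z, s)
    rw [this]⟩
  let κ : 𝒴 × ℤˣ ↪ ε × Bool := ι.trans ⟨r, hrinj⟩
  have hκc : ∀ q, c₀ (κ q).1 = q.2 := fun q => hrc (ι q)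
  have hκv : ∀ q, vt (κ q) = f q := fun q => hrv (ι q)
  let π : Equiv.Perm (𝒴 × ℤˣ) := (Equiv.refl 𝒴).prodCongr (Equiv.neg ℤˣ)
  have hπ : ∀ q, π q = (q.1, -q.2) := fun q => rfl
  let σ₀ : Equiv.Perm (ε × Bool) := π.viaEmbedding κ
  have hσκ : ∀ q, σ₀ (κ q) = κ (q.1, -q.2) := fun q => by
    rw [← hπ]; exact π.viaEmbedding_apply κ q
  have hσn : ∀ h, h ∉ Set.range κ → σ₀ h = h := fun h hh =>
    π.viaEmbedding_apply_of_notMem κ h hh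
  let P : Finset (ε × Bool) := Finset.univ.filter fun h => h ∈ Set.range r
  have hP : ∀ h, h ∈ P ↔ ∃ p, r p = h := fun h => by simp [P]
  have hκP : ∀ q, κ q ∈ P := fun q => (hP _).2 ⟨ι q, rfl⟩
  have h₀ : IsSignedLinking P σ₀ c₀ := by
    refine ⟨fun h => ?_, fun h => ?_, fun h hh => ?_⟩
    · by_cases hr : h ∈ Set.range κ
      · obtain ⟨q, rfl⟩ := hr
        rw [hσκ, hσκ, neg_neg]
      · rw [hσn h hr, hσn h hr]
    · by_cases hr : h ∈ Set.range κ
      · obtain ⟨q, rfl⟩ := hr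
        rw [hσκ]
        exact iff_of_true (hκP _) (hκP _)
      · rw [hσn h hr]
    · by_cases hr : h ∈ Set.range κ
      · obtain ⟨q, rfl⟩ := hr
        rw [hσκ, hκc, hκc]
      · exact absurd (hσn h hr) hh
  obtain ⟨c, hc, hc1, hc2, hc3⟩ := exists_balanced_signs P σ₀ c₀ h₀
  have hcopp : ∀ Y : 𝒴, ∀ s, c (κ (Y, -s)).1 = - c (κ (Y, s)).1 := by
    intro Y s
    rw [← hσκ (Y, s)]
    refine hc.opp _ ?_
    rw [hσκ]
    intro h
    have := congrArg Prod.snd (κ.injective h)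
    exact hne s this.symm
  have hcmeet : ∀ Y : 𝒴, ∀ s, ∃ u ∈ Y.1, u ∈ coveredVertices vt c s := by
    intro Y s
    have h1 := hcopp Y 1
    obtain ⟨t, ht⟩ : ∃ t, c (κ (Y, t)).1 = s := by
      by_cases h : c (κ (Y, 1)).1 = s
      · exact ⟨1, h⟩
      · refine ⟨-1, ?_⟩
        rw [h1]
        rcases Int.units_eq_one_or (c (κ (Y, 1)).1) with h2 | h2 <;>
          rcases Int.units_eq_one_or s with h3 | h3 <;> simp_all
    refine ⟨f (Y, t), hfY _, mem_coveredVertices.2 ⟨κ (Y, t), ht, hκv _⟩⟩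
  -- Two representatives of the same vertex are linked, so they never receive the same new colour.
  -- The colour classes of `P` serve as `v₁` and `v₂`; their sum is `P.card`, whatever the
  -- colouring.
  have hPinj : ∀ s, ((P.filter fun h => c h.1 = s).card) ≤ (coveredVertices vt c s).card := by
    intro s
    refine Finset.card_le_card_of_injOn vt (fun h hh => ?_) fun x hx y hy hxy => ?_
    · rw [Finset.mem_coe, Finset.mem_filter] at hh
      exact mem_coveredVertices.2 ⟨h, hh.2, rfl⟩
    · rw [Finset.mem_coe, Finset.mem_filter, hP] at hx hy
      obtain ⟨⟨p, rfl⟩, hxs⟩ := hx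
      obtain ⟨⟨q, rfl⟩, hys⟩ := hy
      obtain ⟨⟨u, a⟩, hp⟩ := p
      obtain ⟨⟨w, b⟩, hq⟩ := q
      have huw : u = w := by rw [hrv, hrv] at hxy; exact hxy
      subst huw
      by_cases hab : a = b
      · subst hab; rfl
      exfalso
      have hu : ∀ s, u ∈ coveredVertices vt c₀ s := by
        intro s
        rcases hor a b s hab with rfl | rfl
        · exact hp
        · exact hq
      let Y : 𝒴 := ⟨{u}, Or.inl ⟨u, rfl, hu⟩⟩
      have hκr : ∀ s (hs : u ∈ coveredVertices vt c₀ s), κ (Y, s) = r ⟨(u, s), hs⟩ := by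
        intro s hs
        have : f (Y, s) = u := Finset.mem_singleton.1 (hfY (Y, s))
        change r ⟨(f (Y, s), s), _⟩ = _
        congr 3
      obtain rfl := hneg a b hab
      have := hcopp Y a
      rw [hκr a hp, hκr (-a) hq, hxs, hys] at this
      exact hne _ this
  have hPcard : P.card = (coveredVertices vt c₀ 1).card + (coveredVertices vt c₀ (-1)).card := by
    rw [← card_filter_units_add P (fun h => c₀ h.1)]
    have : ∀ s, (P.filter fun h => c₀ h.1 = s).card = (coveredVertices vt c₀ s).card := by
      intro s
      refine Finset.card_bij (fun h _ => vt h) (fun h hh => ?_) (fun x hx y hy hxy => ?_)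
        fun u hu => ?_
      · exact mem_coveredVertices.2 ⟨h, (Finset.mem_filter.1 hh).2, rfl⟩
      · rw [Finset.mem_filter, hP] at hx hy
        obtain ⟨⟨p, rfl⟩, hxs⟩ := hx
        obtain ⟨⟨q, rfl⟩, hys⟩ := hy
        rw [hrv, hrv] at hxy
        rw [hrc] at hxs hys
        exact congrArg r (Subtype.ext (Prod.ext hxy (hxs.trans hys.symm)))
      · exact ⟨r ⟨(u, s), hu⟩, Finset.mem_filter.2 ⟨(hP _).2 ⟨_, rfl⟩, hrc _⟩, hrv _⟩
    rw [this, this]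
  refine ⟨c, fun X hX s => ?_, _, _, hPinj 1, hPinj (-1), ?_, hc1, ?_, ?_⟩
  · by_cases h : ∀ u ∈ X, ¬ ∀ s, u ∈ coveredVertices vt c₀ s
    · exact hcmeet ⟨X, Or.inr ⟨hX, h⟩⟩ s
    · push Not at h
      obtain ⟨u, huX, hu⟩ := h
      obtain ⟨w, hw, hw'⟩ := hcmeet ⟨{u}, Or.inl ⟨u, rfl, hu⟩⟩ s
      rw [Finset.mem_singleton.1 hw] at hw'
      exact ⟨u, huX, hw'⟩
  · rw [card_filter_units_add P (fun h => c h.1), hPcard]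
  · rw [← sum_units_eq_card_sub_card P (fun h => c h.1)]; exact hc2
  · rw [← sum_units_eq_card_sub_card P (fun h => c h.1)]; exact hc3

/-! ### Disjoint branchings -/

/-- The number of arcs of `B` entering `X`. -/
def arcInDegree {V α : Type*} [DecidableEq V] (tail head : α → V) (B : Finset α) (X : Finset V) :
    ℕ :=
  (B.filter fun a => head a ∈ X ∧ tail a ∉ X).card

section Branching

variable {V α : Type*} [DecidableEq V] {tail head : α → V}

theorem arcInDegree_pos_iff {B : Finset α} {X : Finset V} :
    0 < arcInDegree tail head B X ↔ ∃ a ∈ B, head a ∈ X ∧ tail a ∉ X := by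
  simp [arcInDegree, Finset.card_pos, Finset.Nonempty]

/-- Submodularity of the in-degree, which holds for the contribution of each single arc. -/
theorem arcInDegree_inter_add_union_le [DecidableEq α] (B : Finset α) (X Y : Finset V) :
    arcInDegree tail head B (X ∩ Y) + arcInDegree tail head B (X ∪ Y) ≤
      arcInDegree tail head B X + arcInDegree tail head B Y := by
  simp only [arcInDegree, Finset.card_filter, ← Finset.sum_add_distrib]
  refine Finset.sum_le_sum fun a _ => ?_
  by_cases h1 : head a ∈ X <;> by_cases h2 : head a ∈ Y <;> by_cases h3 : tail a ∈ X <;>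
    by_cases h4 : tail a ∈ Y <;> simp [h1, h2, h3, h4]

theorem arcInDegree_erase [DecidableEq α] {B : Finset α} {a : α} (X : Finset V)
    (h : ¬ (head a ∈ X ∧ tail a ∉ X)) :
    arcInDegree tail head (B.erase a) X = arcInDegree tail head B X := by
  unfold arcInDegree
  congr 1
  ext b
  simp only [Finset.mem_filter, Finset.mem_erase]
  constructor
  · tauto
  · rintro ⟨h1, h2⟩
    exact ⟨⟨fun h' => h (h' ▸ h2), h1⟩, h2⟩

theorem arcInDegree_le_erase_add_one [DecidableEq α] (B : Finset α) (a : α) (X : Finset V) :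
    arcInDegree tail head B X ≤ arcInDegree tail head (B.erase a) X + 1 := by
  unfold arcInDegree
  rw [Finset.filter_erase]
  have := Finset.pred_card_le_card_erase (s := B.filter fun a => head a ∈ X ∧ tail a ∉ X) (a := a)
  omega

/-- One step of Lovász's proof of Edmonds' theorem: the first of two disjoint branchings can be
extended by an arc without destroying the cut condition. -/
theorem exists_arc_extension [Fintype V] [DecidableEq α] {B : Finset α} {U S : Finset V}
    (hB : ∀ X : Finset V, X.Nonempty → (if Disjoint X U then 1 else 0) +
      (if Disjoint X S then 1 else 0) ≤ arcInDegree tail head B X) (hU : U ≠ Finset.univ) :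
    ∃ a ∈ B, tail a ∈ U ∧ head a ∉ U ∧ ∀ X : Finset V, X.Nonempty →
      (if Disjoint X (insert (head a) U) then 1 else 0) + (if Disjoint X S then 1 else 0) ≤
        arcInDegree tail head (B.erase a) X := by
  classical
  -- Only sets entered by `a` lose an arc, and their demand from `U` vanishes once `head a` joins
  -- it. So `a` is harmless unless it enters a tight set: one disjoint from `S` of in-degree 1.
  have main : ∀ a, head a ∉ U → (∀ Y : Finset V, Disjoint Y S → arcInDegree tail head B Y = 1 →
      head a ∈ Y → tail a ∉ Y → False) → ∀ X : Finset V, X.Nonempty →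
      (if Disjoint X (insert (head a) U) then 1 else 0) + (if Disjoint X S then 1 else 0) ≤
        arcInDegree tail head (B.erase a) X := by
    intro a ha hY X hX
    have h1 := hB X hX
    by_cases hent : head a ∈ X ∧ tail a ∉ X
    · have h2 : ¬ Disjoint X (insert (head a) U) := fun h =>
        Finset.disjoint_left.1 h hent.1 (Finset.mem_insert_self _ _)
      have h3 := arcInDegree_le_erase_add_one (tail := tail) (head := head) B a X
      rw [if_neg h2]
      by_cases hS : Disjoint X S
      · rw [if_pos hS] at h1 ⊢
        have : arcInDegree tail head B X ≠ 1 := fun h => hY X hS h hent.1 hent.2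
        omega
      · rw [if_neg hS]; omega
    · rw [arcInDegree_erase X hent]
      refine le_trans (Nat.add_le_add_right ?_ _) h1
      by_cases h : Disjoint X U
      · rw [if_pos h]; split_ifs <;> simp
      · have : ¬ Disjoint X (insert (head a) U) := fun h' =>
          h (h'.mono_right (Finset.subset_insert _ _))
        simp [this]
  let bad : Finset (Finset V) := Finset.univ.filter fun X =>
    Disjoint X S ∧ arcInDegree tail head B X = 1 ∧ (X \ U).Nonempty
  rcases bad.eq_empty_or_nonempty with hbad | hbad
  · have hne : (Uᶜ).Nonempty := by
      rw [Finset.nonempty_iff_ne_empty, Ne, Finset.compl_eq_empty_iff]; exact hU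
    have h1 := hB Uᶜ hne
    rw [if_pos disjoint_compl_left] at h1
    obtain ⟨a, haB, ha1, ha2⟩ := arcInDegree_pos_iff.1 (lt_of_lt_of_le (by omega) h1)
    rw [Finset.mem_compl] at ha1
    rw [Finset.notMem_compl] at ha2
    refine ⟨a, haB, ha2, ha1, main a ha1 fun Y hY1 hY2 hY3 _ => ?_⟩
    have : Y ∈ bad := by
      simp only [bad, Finset.mem_filter, Finset.mem_univ, true_and]
      exact ⟨hY1, hY2, _, Finset.mem_sdiff.2 ⟨hY3, ha1⟩⟩
    simp [hbad] at this
  · obtain ⟨X, hX, hmin⟩ := Finset.exists_min_image bad Finset.card hbad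
    simp only [bad, Finset.mem_filter, Finset.mem_univ, true_and] at hX
    obtain ⟨hXS, hX1, hXU⟩ := hX
    have h2 := hB (X \ U) hXU
    rw [if_pos Finset.sdiff_disjoint, if_pos (hXS.mono_left Finset.sdiff_subset)] at h2
    -- `X \ U` needs two entering arcs but `X` has only one, so some arc runs from `X ∩ U` to `X \
    -- U`.
    obtain ⟨a, haB, ha1, ha2, ha3⟩ : ∃ a ∈ B, head a ∈ X \ U ∧ tail a ∉ X \ U ∧ tail a ∈ X := by
      by_contra! hno
      have : arcInDegree tail head B (X \ U) ≤ arcInDegree tail head B X := by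
        refine Finset.card_le_card fun a ha => ?_
        rw [Finset.mem_filter] at ha ⊢
        exact ⟨ha.1, (Finset.mem_sdiff.1 ha.2.1).1, hno a ha.1 ha.2.1 ha.2.2⟩
      omega
    rw [Finset.mem_sdiff] at ha1
    have ha4 : tail a ∈ U := by
      by_contra h; exact ha2 (Finset.mem_sdiff.2 ⟨ha3, h⟩)
    refine ⟨a, haB, ha4, ha1.2, main a ha1.2 fun Y hY1 hY2 hY3 hY4 => ?_⟩
    -- If `a` entered a tight `Y`, submodularity would make `X ∩ Y` tight; it lacks `tail a`,
    -- against minimality of `X`.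
    have hsub := arcInDegree_inter_add_union_le (tail := tail) (head := head) B X Y
    have hi := hB (X ∩ Y) ⟨_, Finset.mem_inter.2 ⟨ha1.1, hY3⟩⟩
    have hu := hB (X ∪ Y) ⟨_, Finset.mem_union_left _ ha1.1⟩
    have hiS : Disjoint (X ∩ Y) S := hXS.mono_left Finset.inter_subset_left
    rw [if_pos hiS] at hi
    rw [if_pos (Finset.disjoint_union_left.2 ⟨hXS, hY1⟩)] at hu
    have hmem : X ∩ Y ∈ bad := by
      simp only [bad, Finset.mem_filter, Finset.mem_univ, true_and]
      exact ⟨hiS, by omega, head a, by simp [ha1, hY3]⟩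
    refine absurd (hmin _ hmem) (not_le.2 (Finset.card_lt_card ?_))
    refine ⟨Finset.inter_subset_left, fun h => hY4 (Finset.mem_inter.1 (h ha3)).2⟩

/-- Edmonds' disjoint branchings theorem for two root sets `U` and `S`. -/
theorem exists_branching [Fintype V] [DecidableEq α] (U S : Finset V) (B : Finset α)
    (hB : ∀ X : Finset V, X.Nonempty → (if Disjoint X U then 1 else 0) +
      (if Disjoint X S then 1 else 0) ≤ arcInDegree tail head B X) :
    ∃ C ⊆ B, C.card + U.card = Fintype.card V ∧
      (∀ X : Finset V, X.Nonempty → Disjoint X U → ∃ a ∈ C, head a ∈ X ∧ tail a ∉ X) ∧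
      (∀ X : Finset V, X.Nonempty → Disjoint X S → ∃ a ∈ B \ C, head a ∈ X ∧ tail a ∉ X) := by
  by_cases hU : U = Finset.univ
  · subst hU
    refine ⟨∅, Finset.empty_subset _, by simp, fun X hX hXU => ?_, fun X hX hXS => ?_⟩
    · obtain ⟨x, hx⟩ := hX
      exact absurd (Finset.mem_univ x) (Finset.disjoint_left.1 hXU hx)
    · have := hB X hX
      rw [if_pos hXS] at this
      rw [Finset.sdiff_empty]
      exact arcInDegree_pos_iff.1 (by omega)
  · obtain ⟨a, haB, ha1, ha2, ha3⟩ := exists_arc_extension hB hU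
    have hlt : (insert (head a) U)ᶜ.card < Uᶜ.card := by
      refine Finset.card_lt_card ⟨?_, fun h => ?_⟩
      · exact Finset.compl_subset_compl.2 (Finset.subset_insert _ _)
      · have := h (Finset.mem_compl.2 ha2)
        simp at this
    obtain ⟨C, hC1, hC2, hC3, hC4⟩ := exists_branching (insert (head a) U) S (B.erase a) ha3
    have haC : a ∉ C := fun h => by simpa using hC1 h
    refine ⟨insert a C, ?_, ?_, fun X hX hXU => ?_, fun X hX hXS => ?_⟩
    · exact Finset.insert_subset haB (hC1.trans (Finset.erase_subset _ _))
    · rw [Finset.card_insert_of_notMem ha2] at hC2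
      rw [Finset.card_insert_of_notMem haC]
      omega
    · by_cases haX : head a ∈ X
      · exact ⟨a, Finset.mem_insert_self _ _, haX, Finset.disjoint_right.1 hXU ha1⟩
      · obtain ⟨b, hb, hb'⟩ := hC3 X hX (Finset.disjoint_insert_right.2 ⟨haX, hXU⟩)
        exact ⟨b, Finset.mem_insert_of_mem hb, hb'⟩
    · obtain ⟨b, hb, hb'⟩ := hC4 X hX hXS
      refine ⟨b, ?_, hb'⟩
      simp only [Finset.mem_sdiff, Finset.mem_erase, Finset.mem_insert] at hb ⊢
      tauto
termination_by Uᶜ.card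
decreasing_by exact hlt

end Branching

/-! ### Rebalancing two mixed edge covers -/

namespace MixedGraph

variable {V E A : Type*}

/-- The cut characterization of mixed edge covers. -/
theorem isMixedEdgeCover_iff_cut [Fintype V] (G : MixedGraph V E A) (F : Finset (E ⊕ A)) :
    G.IsMixedEdgeCover F ↔ ∀ X : Finset V, X.Nonempty →
      (∀ e, Sum.inl e ∈ F → ∀ u ∈ G.ends e, u ∉ X) →
      ∃ a ∈ arcPart F, G.head a ∈ X ∧ G.tail a ∉ X := by
  classical
  constructor
  · rintro hF X ⟨v, hv⟩ hX
    obtain ⟨e, he, u, hu, huv⟩ := hF v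
    have huX := hX e he u hu
    clear hu he
    induction huv with
    | refl => exact absurd hv huX
    | @tail w z _ hwz ih =>
      by_cases hw : w ∈ X
      · exact ih hw
      · obtain ⟨a, ha, rfl, rfl⟩ := hwz
        exact ⟨a, Finset.mem_toRight.2 ha, hv, hw⟩
  · intro h v
    by_contra hv
    -- The cut condition is applied to the set of all unreached vertices.
    obtain ⟨a, ha, ha1, ha2⟩ := h (Finset.univ.filter fun w =>
        ¬ ∃ e, Sum.inl e ∈ F ∧ ∃ u ∈ G.ends e, G.Reachable F u w)
      ⟨v, Finset.mem_filter.2 ⟨Finset.mem_univ _, hv⟩⟩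
      (fun e he u hu huX => (Finset.mem_filter.1 huX).2 ⟨e, he, u, hu, Relation.ReflTransGen.refl⟩)
    simp only [Finset.mem_filter, Finset.mem_univ, true_and, not_not] at ha1 ha2
    obtain ⟨e, he, u, hu, hr⟩ := ha2
    exact ha1 ⟨e, he, u, hu, hr.tail ⟨a, Finset.mem_toRight.1 ha, rfl, rfl⟩⟩

end MixedGraph

/-- An arc set entering every nonempty set disjoint from `U` has at least `|V| - |U|` arcs. -/
theorem card_le_card_add_card_of_cut {V α : Type*} [Fintype V] [DecidableEq V]
    {tail head : α → V} {C : Finset α} {U : Finset V}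
    (h : ∀ X : Finset V, X.Nonempty → Disjoint X U → ∃ a ∈ C, head a ∈ X ∧ tail a ∉ X) :
    Fintype.card V ≤ C.card + U.card := by
  have : Uᶜ ⊆ C.image head := by
    intro u hu
    obtain ⟨a, ha, ha1, _⟩ := h {u} ⟨u, Finset.mem_singleton_self u⟩
      (Finset.disjoint_singleton_left.2 (Finset.mem_compl.1 hu))
    exact Finset.mem_image.2 ⟨a, ha, Finset.mem_singleton.1 ha1⟩
  have h1 := (Finset.card_le_card this).trans Finset.card_image_le
  have h2 := Finset.card_add_card_compl U
  omega

/-- The choice of the numbers of arcs in a balanced pair of covers. -/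
theorem exists_balanced_arc_counts (n a v₁ v₂ : ℕ) (x : ℤ) (h₁ : v₁ ≤ n) (h₂ : v₂ ≤ n)
    (ha : 2 * n ≤ a + (v₁ + v₂)) (hx : |x| ≤ 2) (hv : |(v₁ : ℤ) - v₂| ≤ 2)
    (hxv : |x - (v₁ - v₂)| ≤ 1) :
    ∃ a₁ a₂ : ℕ, a₁ + a₂ = a ∧ n ≤ a₁ + v₁ ∧ n ≤ a₂ + v₂ ∧ |x + (a₁ - a₂)| ≤ 1 ∧
      |(a₁ : ℤ) - a₂| ≤ 2 := by
  obtain ⟨t, ht⟩ := Nat.exists_eq_add_of_le ha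
  obtain ⟨p, rfl⟩ := Nat.exists_eq_add_of_le h₁
  obtain ⟨q, hq⟩ := Nat.exists_eq_add_of_le h₂
  simp only [abs_le] at *
  -- The requirements are `p = n - v₁` and `q = n - v₂`. The surplus `t` is halved, and an odd arc
  -- goes to the side that keeps both differences in range.
  rcases Nat.even_or_odd' t with ⟨r, rfl | rfl⟩
  · exact ⟨p + r, q + r, by omega⟩
  · by_cases h : x - (v₁ - v₂) = -1 ∨ (x - (v₁ - v₂) = 0 ∧ (1 : ℤ) ≤ v₁ - v₂)
    · exact ⟨p + r + 1, q + r, by omega⟩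
    · exact ⟨p + r, q + r + 1, by omega⟩

/-- Every nonempty set without entering arcs contains a minimal such set. -/
theorem exists_minimal_arcInDegree_eq_zero {V α : Type*} [DecidableEq V] {tail head : α → V}
    {B : Finset α} {X : Finset V} (hX : X.Nonempty) (h0 : arcInDegree tail head B X = 0) :
    ∃ Y ⊆ X, Y.Nonempty ∧ arcInDegree tail head B Y = 0 ∧
      ∀ Z ⊆ Y, Z.Nonempty → arcInDegree tail head B Z = 0 → Z = Y := by
  obtain ⟨Y, hY, hmin⟩ := Finset.exists_min_image
    (X.powerset.filter fun Y => Y.Nonempty ∧ arcInDegree tail head B Y = 0) Finset.card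
    ⟨X, by simp [hX, h0]⟩
  rw [Finset.mem_filter, Finset.mem_powerset] at hY
  refine ⟨Y, hY.1, hY.2.1, hY.2.2, fun Z hZ hZn hZ0 => ?_⟩
  refine Finset.eq_of_subset_of_card_le hZ (hmin Z ?_)
  rw [Finset.mem_filter, Finset.mem_powerset]
  exact ⟨hZ.trans hY.1, hZn, hZ0⟩

namespace MixedGraph

variable {V E A : Type*}

/-- Two disjoint mixed edge covers can be replaced by two balanced ones with the same union. -/
theorem exists_balanced_pair [Fintype V] [Fintype E] [DecidableEq V] [DecidableEq E]
    [DecidableEq A] (G : MixedGraph V E A) (F₁ F₂ : Finset (E ⊕ A))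
    (h₁ : G.IsMixedEdgeCover F₁) (h₂ : G.IsMixedEdgeCover F₂) (h₁₂ : Disjoint F₁ F₂) :
    ∃ F₁' F₂' : Finset (E ⊕ A), G.IsMixedEdgeCover F₁' ∧ G.IsMixedEdgeCover F₂' ∧
      Disjoint F₁' F₂' ∧ F₁' ∪ F₂' = F₁ ∪ F₂ ∧
      |(F₁'.card : ℤ) - F₂'.card| ≤ 1 ∧
      |((edgePart F₁').card : ℤ) - (edgePart F₂').card| ≤ 2 ∧
      |((arcPart F₁').card : ℤ) - (arcPart F₂').card| ≤ 2 := by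
  classical
  have hends : ∀ e, ∃ p : Bool → V, ∀ u, u ∈ G.ends e ↔ ∃ b, p b = u := by
    intro e
    induction G.ends e using Sym2.ind with
    | _ x y =>
      refine ⟨fun b => if b then x else y, fun u => ?_⟩
      simp [eq_comm, or_comm]
  choose p hp using hends
  let ε := {e : E // Sum.inl e ∈ F₁ ∪ F₂}
  let vt : ε × Bool → V := fun h => p h.1.1 h.2
  let F : ℤˣ → Finset (E ⊕ A) := fun s => if s = 1 then F₁ else F₂
  have hFc : ∀ s, G.IsMixedEdgeCover (F s) := by
    intro s; simp only [F]; split_ifs <;> assumption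
  have hFs : ∀ s, F s ⊆ F₁ ∪ F₂ := by
    intro s; simp only [F]; split_ifs
    · exact Finset.subset_union_left
    · exact Finset.subset_union_right
  let c₀ : ε → ℤˣ := fun e => if Sum.inl e.1 ∈ F₁ then 1 else -1
  have hc₀ : ∀ (s : ℤˣ) (e : E) (he : Sum.inl e ∈ F s), c₀ ⟨e, hFs s he⟩ = s := by
    intro s e he
    by_cases hs : s = 1
    · subst hs
      have : Sum.inl e ∈ F₁ := by simpa [F] using he
      simp [c₀, this]
    · have : Sum.inl e ∈ F₂ := by simpa [F, hs] using he
      have h' : Sum.inl e ∉ F₁ := Finset.disjoint_right.1 h₁₂ this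
      simp only [c₀, h', if_false]
      exact ((Int.units_eq_one_or s).resolve_left hs).symm
  set B : Finset A := arcPart (F₁ ∪ F₂) with hB
  have hcut : ∀ s, ∀ X : Finset V, X.Nonempty → Disjoint X (coveredVertices vt c₀ s) →
      ∃ a ∈ arcPart (F s), G.head a ∈ X ∧ G.tail a ∉ X := by
    intro s X hX hd
    refine (G.isMixedEdgeCover_iff_cut _).1 (hFc s) X hX fun e he u hu huX => ?_
    obtain ⟨b, rfl⟩ := (hp e u).1 hu
    exact Finset.disjoint_left.1 hd huX
      (mem_coveredVertices.2 ⟨(⟨e, hFs s he⟩, b), hc₀ s e he, rfl⟩)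
  have hFB : ∀ s, arcPart (F s) ⊆ B := fun s => Finset.toRight_subset_toRight (hFs s)
  have hBcard : B.card = (arcPart F₁).card + (arcPart F₂).card := by
    rw [hB]
    unfold arcPart
    rw [Finset.toRight_union, Finset.card_union_of_disjoint]
    rw [Finset.disjoint_left] at h₁₂ ⊢
    intro a ha hb
    exact h₁₂ (Finset.mem_toRight.1 ha) (Finset.mem_toRight.1 hb)
  -- If every such set meets both colours, each nonempty set missing a colour is entered by `B`, as
  -- it contains no member of `𝒳`.
  let 𝒳 : Set (Finset V) := {X | X.Nonempty ∧ arcInDegree G.tail G.head B X = 0 ∧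
    ∀ Z ⊆ X, Z.Nonempty → arcInDegree G.tail G.head B Z = 0 → Z = X}
  have hdisj : ∀ X ∈ 𝒳, ∀ Y ∈ 𝒳, X ≠ Y → Disjoint X Y := by
    rintro X ⟨-, hX0, hX⟩ Y ⟨-, hY0, hY⟩ hXY
    by_contra hd
    rw [Finset.disjoint_iff_inter_eq_empty, ← Ne, ← Finset.nonempty_iff_ne_empty] at hd
    have := arcInDegree_inter_add_union_le (tail := G.tail) (head := G.head) B X Y
    have h0 : arcInDegree G.tail G.head B (X ∩ Y) = 0 := by omega
    exact hXY ((hX _ Finset.inter_subset_left hd h0).symm.trans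
      (hY _ Finset.inter_subset_right hd h0))
  have hmeet : ∀ X ∈ 𝒳, ∀ s, ∃ u ∈ X, u ∈ coveredVertices vt c₀ s := by
    rintro X ⟨hX, hX0, -⟩ s
    by_contra! hno
    obtain ⟨a, ha, ha'⟩ := hcut s X hX (Finset.disjoint_left.2 hno)
    have := arcInDegree_pos_iff.2 ⟨a, hFB s ha, ha'⟩
    omega
  obtain ⟨c, hcmeet, v₁, v₂, hv₁, hv₂, hv, hx, hvb, hxv⟩ :=
    exists_balanced_coloring vt c₀ 𝒳 hdisj hmeet
  have hpos : ∀ s, ∀ X : Finset V, X.Nonempty → Disjoint X (coveredVertices vt c s) →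
      0 < arcInDegree G.tail G.head B X := by
    intro s X hX hd
    by_contra h0
    obtain ⟨Y, hYX, hY⟩ := exists_minimal_arcInDegree_eq_zero hX (Nat.eq_zero_of_not_pos h0)
    obtain ⟨u, hu, hu'⟩ := hcmeet Y hY s
    exact Finset.disjoint_left.1 hd (hYX hu) hu'
  have hsub : ∀ X : Finset V, Disjoint X (coveredVertices vt c 1) →
      Disjoint X (coveredVertices vt c (-1)) → ∀ s, Disjoint X (coveredVertices vt c₀ s) := by
    intro X hX1 hX2 s
    refine Finset.disjoint_left.2 fun u hu hu' => ?_
    obtain ⟨h, -, hh⟩ := mem_coveredVertices.1 hu'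
    rcases Int.units_eq_one_or (c h.1) with h' | h'
    · exact Finset.disjoint_left.1 hX1 hu (mem_coveredVertices.2 ⟨h, h', hh⟩)
    · exact Finset.disjoint_left.1 hX2 hu (mem_coveredVertices.2 ⟨h, h', hh⟩)
  -- A set missing both colours touches no edge, so each of `F₁` and `F₂` supplies an entering arc.
  obtain ⟨C₁, hC₁B, hC₁card, hC₁, hC₁'⟩ := exists_branching (tail := G.tail) (head := G.head)
    (coveredVertices vt c 1) (coveredVertices vt c (-1)) B (by
      intro X hX
      by_cases hX1 : Disjoint X (coveredVertices vt c 1) <;>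
        by_cases hX2 : Disjoint X (coveredVertices vt c (-1))
      · rw [if_pos hX1, if_pos hX2]
        have hd := hsub X hX1 hX2
        obtain ⟨a, ha, ha'⟩ := hcut 1 X hX (hd 1)
        obtain ⟨b, hb, hb'⟩ := hcut (-1) X hX (hd (-1))
        have hab : a ≠ b := by
          rintro rfl
          exact Finset.disjoint_left.1 h₁₂ (Finset.mem_toRight.1 ha) (Finset.mem_toRight.1 hb)
        refine (Finset.card_pair hab).ge.trans (Finset.card_le_card fun d hd => ?_)
        rw [Finset.mem_insert, Finset.mem_singleton] at hd
        rcases hd with rfl | rfl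
        · exact Finset.mem_filter.2 ⟨hFB _ ha, ha'⟩
        · exact Finset.mem_filter.2 ⟨hFB _ hb, hb'⟩
      · rw [if_pos hX1, if_neg hX2]; exact hpos 1 X hX hX1
      · rw [if_neg hX1, if_pos hX2]; exact hpos (-1) X hX hX2
      · rw [if_neg hX1, if_neg hX2]; exact Nat.zero_le _)
  -- With `Finset.univ` as second root set its demand is void; this application only trims `B \ C₁`
  -- to the exact size.
  obtain ⟨C₂, hC₂B, hC₂card, hC₂, -⟩ := exists_branching (tail := G.tail) (head := G.head)
    (coveredVertices vt c (-1)) Finset.univ (B \ C₁) (by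
      intro X hX
      have hXu : ¬ Disjoint X Finset.univ := by
        obtain ⟨x, hx⟩ := hX
        exact fun h => Finset.disjoint_left.1 h hx (Finset.mem_univ x)
      rw [if_neg hXu]
      split_ifs with h
      · exact arcInDegree_pos_iff.2 (hC₁' X hX h)
      · exact Nat.zero_le _)
  have hle : 2 * Fintype.card V ≤ B.card + (v₁ + v₂) := by
    have h1 := card_le_card_add_card_of_cut (hcut 1)
    have h2 := card_le_card_add_card_of_cut (hcut (-1))
    have e1 : F 1 = F₁ := rfl
    have e2 : F (-1) = F₂ := rfl
    rw [e1] at h1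
    rw [e2] at h2
    omega
  obtain ⟨a₁, a₂, haB, ha₁, ha₂, hbal, hbala⟩ := exists_balanced_arc_counts _ B.card v₁ v₂ _
    (hv₁.trans (Finset.card_le_univ _)) (hv₂.trans (Finset.card_le_univ _)) hle hx hvb hxv
  have hC₁C₂ : C₁ ⊆ B \ C₂ := fun a ha => Finset.mem_sdiff.2
    ⟨hC₁B ha, fun h => (Finset.mem_sdiff.1 (hC₂B h)).2 ha⟩
  have hC₂B' : C₂ ⊆ B := hC₂B.trans Finset.sdiff_subset
  -- Adding arcs preserves a cover, so any set of `a₁` arcs between `C₁` and `B \ C₂` will do.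
  obtain ⟨D₁, hCD₁, hD₁, hD₁card⟩ := Finset.exists_subsuperset_card_eq (n := a₁) hC₁C₂ (by omega)
    (by rw [Finset.card_sdiff_of_subset hC₂B']; omega)
  have hD₁B : D₁ ⊆ B := hD₁.trans Finset.sdiff_subset
  have hD₂card : (B \ D₁).card = a₂ := by rw [Finset.card_sdiff_of_subset hD₁B]; omega
  have hCD₂ : C₂ ⊆ B \ D₁ := fun a ha => Finset.mem_sdiff.2
    ⟨hC₂B' ha, fun h => (Finset.mem_sdiff.1 (hD₁ h)).2 ha⟩
  let Q : ℤˣ → Finset E := fun s =>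
    (Finset.univ.filter fun e : ε => c e = s).map (Function.Embedding.subtype _)
  have hQ : ∀ s e, e ∈ Q s ↔ ∃ h : Sum.inl e ∈ F₁ ∪ F₂, c ⟨e, h⟩ = s := by
    intro s e
    simp [Q]
  have hcover : ∀ s (D : Finset A), (∀ X : Finset V, X.Nonempty →
      Disjoint X (coveredVertices vt c s) → ∃ a ∈ D, G.head a ∈ X ∧ G.tail a ∉ X) →
      G.IsMixedEdgeCover ((Q s).disjSum D) := by
    intro s D hD
    refine (G.isMixedEdgeCover_iff_cut _).2 fun X hX hno => ?_
    unfold arcPart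
    rw [Finset.toRight_disjSum]
    refine hD X hX (Finset.disjoint_left.2 fun u hu hu' => ?_)
    obtain ⟨⟨⟨e, he⟩, b⟩, hh, rfl⟩ := mem_coveredVertices.1 hu'
    exact hno e (Finset.inl_mem_disjSum.2 ((hQ s e).2 ⟨he, hh⟩)) _ ((hp e _).2 ⟨b, rfl⟩) hu
  have hsum : ∑ e, (c e : ℤ) = ((Q 1).card : ℤ) - (Q (-1)).card := by
    rw [sum_units_eq_card_sub_card, Finset.card_map, Finset.card_map]
  rw [hsum] at hx hbal
  refine ⟨(Q 1).disjSum D₁, (Q (-1)).disjSum (B \ D₁), hcover 1 D₁ fun X hX hd => ?_,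
    hcover (-1) _ fun X hX hd => ?_, ?_, ?_, ?_, ?_, ?_⟩
  · obtain ⟨a, ha, ha'⟩ := hC₁ X hX hd
    exact ⟨a, hCD₁ ha, ha'⟩
  · obtain ⟨a, ha, ha'⟩ := hC₂ X hX hd
    exact ⟨a, hCD₂ ha, ha'⟩
  · refine Finset.disjoint_left.2 fun z hz hz' => ?_
    rcases z with e | a
    · rw [Finset.inl_mem_disjSum, hQ] at hz hz'
      obtain ⟨h, h1⟩ := hz
      obtain ⟨_, h2⟩ := hz'
      rw [h1] at h2
      exact absurd h2 (by decide)
    · rw [Finset.inr_mem_disjSum] at hz hz'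
      exact (Finset.mem_sdiff.1 hz').2 hz
  · ext z
    rcases z with e | a
    · rw [Finset.mem_union, Finset.inl_mem_disjSum, Finset.inl_mem_disjSum, hQ, hQ]
      constructor
      · rintro (⟨h, -⟩ | ⟨h, -⟩) <;> exact h
      · intro h
        rcases Int.units_eq_one_or (c ⟨e, h⟩) with h' | h'
        · exact Or.inl ⟨h, h'⟩
        · exact Or.inr ⟨h, h'⟩
    · rw [Finset.mem_union, Finset.inr_mem_disjSum, Finset.inr_mem_disjSum, ← Finset.mem_union,
        Finset.union_sdiff_of_subset hD₁B, hB]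
      exact Finset.mem_toRight
  · rw [Finset.card_disjSum, Finset.card_disjSum, hD₁card, hD₂card]
    push_cast
    rw [abs_le] at hbal ⊢
    omega
  · simpa [edgePart] using hx
  · simpa [arcPart, hD₁card, hD₂card] using hbala

end MixedGraph

/-! ### The potential and the general case -/

/-- The differences of a balanced pair are smaller than those of an unbalanced pair. -/
theorem sq_difference_lt {x y x' y' : ℤ} (h₁ : |x' + y'| ≤ 1) (h₂ : |x'| ≤ 2) (h₃ : |y'| ≤ 2)
    (hbad : ¬ (|x + y| ≤ 1 ∧ |x| ≤ 2 ∧ |y| ≤ 2)) :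
    2 * (x' + y') ^ 2 + x' ^ 2 + y' ^ 2 < 2 * (x + y) ^ 2 + x ^ 2 + y ^ 2 := by
  -- Equality occurs at `(2, -2)`. An unbalanced pair scores at least 9 + 4 if `|x + y| ≤ 1`, and at
  -- least 8 + 2 otherwise.
  have hnew : 2 * (x' + y') ^ 2 + x' ^ 2 + y' ^ 2 ≤ 8 := by
    obtain ⟨h₂, h₂'⟩ := abs_le.1 h₂
    obtain ⟨h₃, h₃'⟩ := abs_le.1 h₃
    rw [abs_le] at h₁
    interval_cases x' <;> interval_cases y' <;> omega
  have big : ∀ z m : ℤ, 0 ≤ m → m ≤ |z| → m ^ 2 ≤ z ^ 2 := fun z m hm hz => by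
    rw [← sq_abs z]; exact pow_le_pow_left₀ hm hz 2
  have hz : 0 ≤ (x + y) ^ 2 := sq_nonneg _
  have hd : 0 ≤ (x - y) ^ 2 := sq_nonneg _
  have hpar : 2 * (x ^ 2 + y ^ 2) = (x + y) ^ 2 + (x - y) ^ 2 := by ring
  by_cases hs : |x + y| ≤ 1
  · have hxy : (3 ≤ |x| ∧ 2 ≤ |y|) ∨ (2 ≤ |x| ∧ 3 ≤ |y|) := by
      simp only [abs_le, le_abs] at *
      omega
    rcases hxy with ⟨hx, hy⟩ | ⟨hx, hy⟩
    · have := big x 3 (by norm_num) hx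
      have := big y 2 (by norm_num) hy
      linarith
    · have := big x 2 (by norm_num) hx
      have := big y 3 (by norm_num) hy
      linarith
  · have := big (x + y) 2 (by norm_num) (by omega)
    linarith

/-- Replacing a badly balanced pair of sizes by a balanced one decreases the sum of squares. -/
theorem sq_potential_lt {e₁ e₂ a₁ a₂ e₁' e₂' a₁' a₂' : ℤ} (he : e₁' + e₂' = e₁ + e₂)
    (ha : a₁' + a₂' = a₁ + a₂) (h₁ : |(e₁' + a₁') - (e₂' + a₂')| ≤ 1) (h₂ : |e₁' - e₂'| ≤ 2)
    (h₃ : |a₁' - a₂'| ≤ 2)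
    (hbad : ¬ (|(e₁ + a₁) - (e₂ + a₂)| ≤ 1 ∧ |e₁ - e₂| ≤ 2 ∧ |a₁ - a₂| ≤ 2)) :
    2 * (e₁' + a₁') ^ 2 + e₁' ^ 2 + a₁' ^ 2 + (2 * (e₂' + a₂') ^ 2 + e₂' ^ 2 + a₂' ^ 2) <
      2 * (e₁ + a₁) ^ 2 + e₁ ^ 2 + a₁ ^ 2 + (2 * (e₂ + a₂) ^ 2 + e₂ ^ 2 + a₂ ^ 2) := by
  rw [add_sub_add_comm] at h₁ hbad
  -- For fixed sums, a sum of two squares is a constant plus half the squared difference.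
  have key := sq_difference_lt h₁ h₂ h₃ hbad
  obtain rfl : e₂ = e₁' + e₂' - e₁ := by linarith
  obtain rfl : a₂ = a₁' + a₂' - a₁ := by linarith
  nlinarith

theorem MixedGraph.edgePart_card_add_arcPart_card {E A : Type*} (F : Finset (E ⊕ A)) :
    (edgePart F).card + (arcPart F).card = F.card :=
  Finset.card_toLeft_add_card_toRight

theorem theorem3 {V E A : Type*} [Finite V] [Finite E] [Finite A] (G : MixedGraph V E A) (k : ℕ)
    (hG : ∃ F : Fin k → Finset (E ⊕ A), G.IsMixedEdgeCoverPartition F) :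
    ∃ F : Fin k → Finset (E ⊕ A), G.IsMixedEdgeCoverPartition F ∧
      ∀ i j : Fin k,
        |((F i).card : ℤ) - ((F j).card : ℤ)| ≤ 1 ∧
        |((MixedGraph.edgePart (F i)).card : ℤ) - ((MixedGraph.edgePart (F j)).card : ℤ)| ≤ 2 ∧
        |((MixedGraph.arcPart (F i)).card : ℤ) - ((MixedGraph.arcPart (F j)).card : ℤ)| ≤ 2 := by
  classical
  have := Fintype.ofFinite V
  have := Fintype.ofFinite E
  have := Fintype.ofFinite A
  -- The factor 2 matters: without it the forbidden (edge, arc) differences `(2, 0)` would score the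
  -- same as the permitted `(2, -2)`.
  let w : Finset (E ⊕ A) → ℤ := fun F =>
    2 * (((MixedGraph.edgePart F).card : ℤ) + (MixedGraph.arcPart F).card) ^ 2 +
      ((MixedGraph.edgePart F).card : ℤ) ^ 2 + ((MixedGraph.arcPart F).card : ℤ) ^ 2
  obtain ⟨F₀, hF₀⟩ := hG
  obtain ⟨F, hF, hmin⟩ := Finset.exists_min_image
    (Finset.univ.filter fun F : Fin k → Finset (E ⊕ A) => G.IsMixedEdgeCoverPartition F)
    (fun F => ∑ i, w (F i)) ⟨F₀, by simpa using hF₀⟩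
  simp only [Finset.mem_filter, Finset.mem_univ, true_and] at hF hmin
  refine ⟨F, hF, fun i j => ?_⟩
  obtain ⟨hcov, hdis, hall⟩ := hF
  by_cases hij : i = j
  · subst hij; simp
  by_contra hbad
  obtain ⟨F₁, F₂, h₁, h₂, h₁₂, hun, hb, hbe, hba⟩ :=
    G.exists_balanced_pair (F i) (F j) (hcov i) (hcov j) (hdis i j hij)
  let F' : Fin k → Finset (E ⊕ A) := Function.update (Function.update F i F₁) j F₂
  have hi : F' i = F₁ := by simp [F', Function.update_of_ne hij]
  have hj : F' j = F₂ := by simp [F']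
  have ho : ∀ l, l ≠ i → l ≠ j → F' l = F l := fun l hli hlj => by
    simp [F', Function.update_of_ne hlj, Function.update_of_ne hli]
  have hsub₁ : F₁ ⊆ F i ∪ F j := hun ▸ Finset.subset_union_left
  have hsub₂ : F₂ ⊆ F i ∪ F j := hun ▸ Finset.subset_union_right
  have hout : ∀ l, l ≠ i → l ≠ j → Disjoint (F l) (F i ∪ F j) := fun l hli hlj =>
    Finset.disjoint_union_right.2 ⟨hdis l i hli, hdis l j hlj⟩
  have hpart : G.IsMixedEdgeCoverPartition F' := by
    refine ⟨fun l => ?_, fun l m hlm => ?_, fun x => ?_⟩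
    · by_cases hlj : l = j
      · rw [hlj, hj]; exact h₂
      by_cases hli : l = i
      · rw [hli, hi]; exact h₁
      rw [ho l hli hlj]; exact hcov l
    · have wlog_out : ∀ l m, l ≠ m → l ≠ i → l ≠ j → Disjoint (F' l) (F' m) := by
        intro l m hlm hli hlj
        rw [ho l hli hlj]
        by_cases hmj : m = j
        · rw [hmj, hj]; exact (hout l hli hlj).mono_right hsub₂
        by_cases hmi : m = i
        · rw [hmi, hi]; exact (hout l hli hlj).mono_right hsub₁
        rw [ho m hmi hmj]; exact hdis l m hlm
      by_cases hl : l ≠ i ∧ l ≠ j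
      · exact wlog_out l m hlm hl.1 hl.2
      by_cases hm : m ≠ i ∧ m ≠ j
      · exact (wlog_out m l hlm.symm hm.1 hm.2).symm
      have : (l = i ∧ m = j) ∨ (l = j ∧ m = i) := by
        have : ¬ (l = i ∧ m = i) := fun h => hlm (h.1.trans h.2.symm)
        have : ¬ (l = j ∧ m = j) := fun h => hlm (h.1.trans h.2.symm)
        tauto
      rcases this with ⟨rfl, rfl⟩ | ⟨rfl, rfl⟩
      · rw [hi, hj]; exact h₁₂
      · rw [hi, hj]; exact h₁₂.symm
    · obtain ⟨l, hl⟩ := hall x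
      by_cases hlij : l ≠ i ∧ l ≠ j
      · exact ⟨l, by rw [ho l hlij.1 hlij.2]; exact hl⟩
      have hx : x ∈ F₁ ∪ F₂ := by
        rw [hun, Finset.mem_union]
        by_cases hli : l = i
        · exact Or.inl (hli ▸ hl)
        · have hlj : l = j := by tauto
          exact Or.inr (hlj ▸ hl)
      rcases Finset.mem_union.1 hx with h | h
      · exact ⟨i, by rw [hi]; exact h⟩
      · exact ⟨j, by rw [hj]; exact h⟩
  have hsplit : ∀ H : Fin k → Finset (E ⊕ A), ∑ l, w (H l) =
      w (H i) + w (H j) + ∑ l ∈ (Finset.univ.erase i).erase j, w (H l) := by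
    intro H
    rw [← Finset.add_sum_erase _ _ (Finset.mem_univ i), ← Finset.add_sum_erase _ _
      (Finset.mem_erase.2 ⟨Ne.symm hij, Finset.mem_univ j⟩), ← add_assoc]
  have hle := hmin F' hpart
  have hrest : ∑ l ∈ (Finset.univ.erase i).erase j, w (F' l) =
      ∑ l ∈ (Finset.univ.erase i).erase j, w (F l) := by
    refine Finset.sum_congr rfl fun l hl => ?_
    simp only [Finset.mem_erase] at hl
    rw [ho l hl.2.1 hl.1]
  rw [hsplit F, hsplit F', hrest, hi, hj] at hle
  have hedge : (MixedGraph.edgePart F₁).card + (MixedGraph.edgePart F₂).card =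
      (MixedGraph.edgePart (F i)).card + (MixedGraph.edgePart (F j)).card := by
    have hl : ∀ S T : Finset (E ⊕ A), Disjoint S T →
        (MixedGraph.edgePart S).card + (MixedGraph.edgePart T).card = (S ∪ T).toLeft.card := by
      intro S T hST
      rw [Finset.toLeft_union, Finset.card_union_of_disjoint]
      · rfl
      · exact Finset.disjoint_left.2 fun e he he' =>
          Finset.disjoint_left.1 hST (Finset.mem_toLeft.1 he) (Finset.mem_toLeft.1 he')
    rw [hl _ _ h₁₂, hl _ _ (hdis i j hij), hun]
  have hcard : F₁.card + F₂.card = (F i).card + (F j).card := by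
    rw [← Finset.card_union_of_disjoint h₁₂, ← Finset.card_union_of_disjoint (hdis i j hij), hun]
  have c1 := MixedGraph.edgePart_card_add_arcPart_card F₁
  have c2 := MixedGraph.edgePart_card_add_arcPart_card F₂
  have ci := MixedGraph.edgePart_card_add_arcPart_card (F i)
  have cj := MixedGraph.edgePart_card_add_arcPart_card (F j)
  rw [← c1, ← c2] at hb
  rw [← ci, ← cj] at hbad
  push_cast at hb hbad
  refine absurd hle (not_le.2 (add_lt_add_left (sq_potential_lt ?_ ?_ hb hbe hba hbad) _)) <;> omega
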